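/- Let $K$ be a field, let $B$ be a finite dimensional, non-semisimple $K$-algebra, let $M$ be a finite dimensional right $B$-module which is a generator-cogenerator (every finite dimensional right $B$-module is a quotient of some $M^n$ and embeds into some $M^n$), let $A=\operatorname{End}_B(M)$, and let $d\ge 2$ be an integer. All modules are finite dimensional right modules. The dominant dimension of a module $X$ with minimal injective resolution $0\to X\to I_0\to I_1\to\cdots$ is $\sup\{n\ge 0\mid I_i\text{ is projective for all }0\le i<n\}\in\{0,1,2,\dots\}\cup\{\infty\}$, and the dominant dimension of $A$ is that of the regular module $A_A$. Let $\operatorname{proj}(A)$ be the class of projective $A$-modules and $\operatorname{Dom}_d(A)$ the class of $A$-modules of dominant dimension at least $d$. Let $\operatorname{add}(M)$ be the class of direct summands of the modules $M^n$; $M$ is called maximal $n$-orthogonal if $$\operatorname{add}(M)=\{X\mid \operatorname{Ext}^i_B(Y,X)=0\ \text{for all}\ Y\in\operatorname{add}(M),\ 1\le i\le n\}=\{X\mid \operatorname{Ext}^i_B(X,Y)=0\ \text{for all}\ Y\in\operatorname{add}(M),\ 1\le i\le n\}$$ (for $n=0$ the condition on $\operatorname{Ext}$ is empty). Then the following are equivalent: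 1. $\operatorname{proj}(A)=\operatorname{Dom}_d(A)$. 2. $A$ has dominant dimension equal to $d$ and global dimension equal to $d$. 3. $M$ is maximal $(d-2)$-orthogonal. -/

import Mathlib

universe u w

namespace DomDim

open CategoryTheory CategoryTheory.Abelian

section Modules

/- All notions are set up for left modules over a ring `R`.  Right modules over a ring `S` are the
modules over `R = Sᵐᵒᵖ`. -/
variable {R : Type u} [Ring R]

/-- An injective resolution `0 → X → I⁰ → I¹ → ⋯` is minimal if every `Iⁿ` is an essential extension
of the kernel of `Iⁿ → Iⁿ⁺¹`, that is, every nonzero submodule of `Iⁿ` meets this kernel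
nontrivially.  (By exactness the kernel is the image of `X` for `n = 0`, and the image of
`Iⁿ⁻¹ → Iⁿ` for `n > 0`, so that `Iⁿ` is its injective hull.) -/
def IsMinimal {X : ModuleCat.{u} R} (I : InjectiveResolution X) : Prop :=
  ∀ (n : ℕ) (N : Submodule R (I.cocomplex.X n)),
    N ⊓ LinearMap.ker (I.cocomplex.d n (n + 1)).hom = ⊥ → N = ⊥

/-- The dominant dimension of `X`: the number of terms (possibly `∞`) before the first nonprojective
term `Iⁱ` of a minimal injective resolution of `X`; this is `0` if `I⁰` is not projective, and
`sup {n | Iⁱ is projective for i = 0, …, n} + 1` otherwise.  Minimal injective resolutions exist and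
are unique up to isomorphism, so the supremum over `I` is the common value for all of them. -/
noncomputable def domDim (X : ModuleCat.{u} R) : ℕ∞ :=
  ⨆ (I : InjectiveResolution X) (_ : IsMinimal I) (n : ℕ)
    (_ : ∀ i < n, Projective (I.cocomplex.X i)), (n : ℕ∞)

variable (R) in
/-- `Dom_d`: the finitely generated modules of dominant dimension at least `d`. -/
def Dom (d : ℕ) : ObjectProperty (ModuleCat.{u} R) :=
  fun X => Module.Finite R X ∧ (d : ℕ∞) ≤ domDim X

variable (R) in
/-- `proj`: the finitely generated projective modules. -/
def proj : ObjectProperty (ModuleCat.{u} R) :=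
  fun X => Module.Finite R X ∧ Projective X

variable (R) in
/-- The global dimension: the supremum of the projective dimensions of the finitely generated
modules (`⊥` for the zero ring, where the zero module is the only one). -/
noncomputable def glDim : WithBot ℕ∞ :=
  ⨆ (X : ModuleCat.{u} R) (_ : Module.Finite R X), projectiveDimension X

/-- `add M`: the direct summands of the finite direct sums `Mⁿ`. -/
def add (M : ModuleCat.{u} R) : ObjectProperty (ModuleCat.{u} R) :=
  fun X => ∃ n : ℕ, Nonempty (Retract X (ModuleCat.of R (Fin n → M)))

/-- `𝒳^{⊥ n}`: the finitely generated `X` with `Extⁱ(Y, X) = 0` for all `Y ∈ 𝒳`, `1 ≤ i ≤ n`. -/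
def rightPerp (P : ObjectProperty (ModuleCat.{u} R)) (n : ℕ) : ObjectProperty (ModuleCat.{u} R) :=
  fun X => Module.Finite R X ∧ ∀ Y, P Y → ∀ i, 1 ≤ i → i ≤ n → Subsingleton (Ext Y X i)

/-- `^{⊥ n}𝒳`: the finitely generated `X` with `Extⁱ(X, Y) = 0` for all `Y ∈ 𝒳`, `1 ≤ i ≤ n`. -/
def leftPerp (P : ObjectProperty (ModuleCat.{u} R)) (n : ℕ) : ObjectProperty (ModuleCat.{u} R) :=
  fun X => Module.Finite R X ∧ ∀ Y, P Y → ∀ i, 1 ≤ i → i ≤ n → Subsingleton (Ext X Y i)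

/-- `M` is maximal `n`-orthogonal: `add M = M^{⊥ n} = ^{⊥ n}M`. -/
def IsMaximalOrthogonal (M : ModuleCat.{u} R) (n : ℕ) : Prop :=
  add M = rightPerp (add M) n ∧ add M = leftPerp (add M) n

/-- Every finitely generated module is a quotient of some `Mⁿ`. -/
def IsGenerator (M : ModuleCat.{u} R) : Prop :=
  ∀ X : ModuleCat.{u} R, Module.Finite R X →
    ∃ (n : ℕ) (f : (Fin n → M) →ₗ[R] X), Function.Surjective f

/-- Every finitely generated module embeds into some `Mⁿ`. -/
def IsCogenerator (M : ModuleCat.{u} R) : Prop :=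
  ∀ X : ModuleCat.{u} R, Module.Finite R X →
    ∃ (n : ℕ) (f : X →ₗ[R] (Fin n → M)), Function.Injective f

end Modules

section Algebras

variable (A : Type u) [Ring A]

/-- The dominant dimension of a ring: that of the regular right module `A_A`. -/
noncomputable def algDomDim : ℕ∞ := domDim (ModuleCat.of Aᵐᵒᵖ A)

end Algebras

end DomDim

namespace DomDim

open CategoryTheory CategoryTheory.Abelian CategoryTheory.Limits

section Hull

variable {R : Type u} [Ring R]

/-- Every submodule of an injective module has an essential extension in it that is injective. -/
theorem exists_injective_essential_extension {J : Type u} [AddCommGroup J] [Module R J]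
    [Module.Injective R J] (X : Submodule R J) :
    ∃ E : Submodule R J, X ≤ E ∧ Module.Injective R E ∧ ∀ N ≤ E, N ⊓ X = ⊥ → N = ⊥ := by
  obtain ⟨E, hXE, hE⟩ := zorn_le_nonempty₀
    {E : Submodule R J | X ≤ E ∧ ∀ N ≤ E, N ⊓ X = ⊥ → N = ⊥} (by
      intro c hc hchain y hy
      refine ⟨sSup c, ⟨(hc hy).1.trans (le_sSup hy), fun N hN h => ?_⟩, fun z hz => le_sSup hz⟩
      rw [eq_bot_iff]
      intro x hx
      obtain ⟨E, hE, hxE⟩ := (Submodule.mem_sSup_of_directed ⟨y, hy⟩ hchain.directedOn).1 (hN hx)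
      have hs : Submodule.span R {x} = ⊥ := (hc hE).2 _
        ((Submodule.span_singleton_le_iff_mem _ _).2 hxE)
        (eq_bot_iff.2 (h ▸ inf_le_inf_right X ((Submodule.span_singleton_le_iff_mem _ _).2 hx)))
      simpa using hs)
    X ⟨le_rfl, fun N hN h => by rwa [inf_eq_left.2 hN] at h⟩
  obtain ⟨C, -, hC⟩ := zorn_le_nonempty₀ {C : Submodule R J | C ⊓ E = ⊥} (by
      intro c hc hchain y hy
      refine ⟨sSup c, ?_, fun z hz => le_sSup hz⟩
      rw [Set.mem_ofPred_eq, eq_bot_iff]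
      rintro x ⟨hx, hxE⟩
      obtain ⟨C, hC, hxC⟩ := (Submodule.mem_sSup_of_directed ⟨y, hy⟩ hchain.directedOn).1 hx
      have h0 := hc hC
      rw [Set.mem_ofPred_eq] at h0
      rw [← h0]
      exact ⟨hxC, hxE⟩)
    ⊥ (by simp)
  have hCE : C ⊓ E = ⊥ := hC.prop
  have hbig : ∀ C' : Submodule R J, C ≤ C' → C' ⊓ E = ⊥ → C' ≤ C := fun C' h h' =>
    hC.le_of_ge h' h
  have hinj : Function.Injective (C.mkQ ∘ₗ E.subtype) := by
    rw [← LinearMap.ker_eq_bot, eq_bot_iff]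
    rintro ⟨x, hxE⟩ hx
    have hxC : x ∈ C := by simpa using hx
    have : x ∈ C ⊓ E := ⟨hxC, hxE⟩
    rw [hCE] at this
    simpa using this
  obtain ⟨g, hg⟩ := Module.Injective.out (C.mkQ ∘ₗ E.subtype) hinj E.subtype
  have hgE : ∀ x ∈ E, g (C.mkQ x) = x := fun x hx => hg ⟨x, hx⟩
  have hkey : ∀ N : Submodule R J, N ⊓ E = ⊥ → ∀ y, g (C.mkQ y) ∈ N → y ∈ C := by
    intro N hN y hy
    refine hbig (N.comap (g ∘ₗ C.mkQ)) ?_ ?_ hy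
    · intro c hc
      have : C.mkQ c = 0 := by simpa using hc
      simp only [Submodule.mem_comap, LinearMap.comp_apply, this, map_zero, N.zero_mem]
    · rw [eq_bot_iff]
      rintro x ⟨hx, hxE⟩
      have : x ∈ N ⊓ E := ⟨by
        have h : g (C.mkQ x) ∈ N := hx
        rwa [hgE x hxE] at h, hxE⟩
      rwa [hN] at this
  have hrange : LinearMap.range (g ∘ₗ C.mkQ) ≤ E := by
    refine hE.le_of_ge ⟨?_, ?_⟩ ?_
    · exact fun x hx => ⟨x, hgE x (hXE hx)⟩
    · intro N hN h
      have hNE : N ⊓ E = ⊥ := hE.prop.2 _ inf_le_right (eq_bot_iff.2 (h ▸ by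
        rintro x ⟨⟨hx, -⟩, hx'⟩
        exact ⟨hx, hx'⟩))
      rw [eq_bot_iff]
      intro x hx
      obtain ⟨y, rfl⟩ := hN hx
      have : C.mkQ y = 0 := by simpa using hkey N hNE y hx
      simp [this]
    · exact fun x hx => ⟨x, hgE x hx⟩
  refine ⟨E, hXE, ⟨fun X' Y' _ _ _ _ f hf φ => ?_⟩, hE.prop.2⟩
  obtain ⟨ψ, hψ⟩ := Module.Injective.out f hf (E.subtype ∘ₗ φ)
  refine ⟨((g ∘ₗ C.mkQ).codRestrict E fun y => hrange ⟨y, rfl⟩) ∘ₗ ψ, fun x => ?_⟩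
  ext
  simp only [LinearMap.comp_apply, LinearMap.codRestrict_apply, hψ]
  exact hgE _ (φ x).2

/-- A morphism of modules whose image meets every nonzero submodule nontrivially. -/
def IsEssential {X E : ModuleCat.{u} R} (f : X ⟶ E) : Prop :=
  ∀ N : Submodule R E, N ⊓ LinearMap.range f.hom = ⊥ → N = ⊥

theorem IsEssential.mono {X E W : ModuleCat.{u} R} {f : X ⟶ E} (hf : IsEssential f) (g : E ⟶ W)
    [Mono (f ≫ g)] : Mono g := by
  rw [ModuleCat.mono_iff_ker_eq_bot]
  apply hf
  rw [eq_bot_iff]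
  rintro _ ⟨hy, x, rfl⟩
  have hinj := (ModuleCat.mono_iff_injective (f ≫ g)).1 inferInstance
  have : x = 0 := hinj (by simpa using hy)
  simp [this]

theorem exists_injective_hull (X : ModuleCat.{u} R) :
    ∃ (E : ModuleCat.{u} R) (f : X ⟶ E), Mono f ∧ Injective E ∧ IsEssential f := by
  have hι : Function.Injective (Injective.ι X).hom :=
    (ModuleCat.mono_iff_injective _).1 inferInstance
  have : Module.Injective R (Injective.under X : ModuleCat.{u} R) :=
    (Module.injective_iff_injective_object R _).2 (Injective.injective_under X)
  obtain ⟨E, hXE, hE, hess⟩ :=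
    exists_injective_essential_extension (LinearMap.range (Injective.ι X).hom)
  refine ⟨ModuleCat.of R E, ModuleCat.ofHom
    ((Injective.ι X).hom.codRestrict E fun x => hXE ⟨x, rfl⟩), ?_, ?_, ?_⟩
  · rw [ModuleCat.mono_iff_injective]
    intro x y hxy
    exact hι (congrArg Subtype.val hxy)
  · exact (Module.injective_iff_injective_object R E).1 hE
  · intro N hN
    have h := hess (N.map E.subtype) (Submodule.map_subtype_le E N) (by
      rw [eq_bot_iff]
      rintro _ ⟨⟨y, hy, rfl⟩, x, hx⟩
      have : y ∈ N ⊓ LinearMap.range (ModuleCat.ofHom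
          ((Injective.ι X).hom.codRestrict E fun x => hXE ⟨x, rfl⟩)).hom :=
        ⟨hy, x, Subtype.ext hx⟩
      rw [hN] at this
      simpa using this)
    exact Submodule.map_injective_of_injective E.injective_subtype
      (h.trans (Submodule.map_bot _).symm)

/-- A chosen injective hull. -/
noncomputable def injHull (X : ModuleCat.{u} R) : ModuleCat.{u} R :=
  (exists_injective_hull X).choose

/-- The embedding into the chosen injective hull. -/
noncomputable def toInjHull (X : ModuleCat.{u} R) : X ⟶ injHull X :=
  (exists_injective_hull X).choose_spec.choose

instance (X : ModuleCat.{u} R) : Mono (toInjHull X) :=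
  (exists_injective_hull X).choose_spec.choose_spec.1

instance (X : ModuleCat.{u} R) : Injective (injHull X) :=
  (exists_injective_hull X).choose_spec.choose_spec.2.1

theorem isEssential_toInjHull (X : ModuleCat.{u} R) : IsEssential (toInjHull X) :=
  (exists_injective_hull X).choose_spec.choose_spec.2.2

/-- The iterated cosyzygies formed with the chosen injective hulls. -/
noncomputable def cosyzygy (X : ModuleCat.{u} R) : ℕ → ModuleCat.{u} R
  | 0 => X
  | n + 1 => cokernel (toInjHull (cosyzygy X n))

/-- The projection of a chosen injective hull onto the next cosyzygy. -/
noncomputable def toCosyzygy (X : ModuleCat.{u} R) (n : ℕ) :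
    injHull (cosyzygy X n) ⟶ cosyzygy X (n + 1) :=
  cokernel.π (toInjHull (cosyzygy X n))

instance (X : ModuleCat.{u} R) (n : ℕ) : Epi (toCosyzygy X n) :=
  inferInstanceAs (Epi (cokernel.π _))

@[simp]
theorem toInjHull_toCosyzygy (X : ModuleCat.{u} R) (n : ℕ) :
    toInjHull (cosyzygy X n) ≫ toCosyzygy X n = 0 :=
  cokernel.condition _

theorem exact_toCosyzygy (X : ModuleCat.{u} R) (n : ℕ) :
    (ShortComplex.mk _ _ (toInjHull_toCosyzygy X n)).Exact :=
  ShortComplex.exact_cokernel _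

theorem exact_epi_comp {X E F G : ModuleCat.{u} R} (f : X ⟶ E) (g : E ⟶ F) (h : F ⟶ G) [Epi f]
    (w : g ≫ h = 0) (hgh : (ShortComplex.mk g h w).Exact) :
    (ShortComplex.mk (f ≫ g) h (by simp [w])).Exact := by
  let φ : ShortComplex.mk (f ≫ g) h (by simp [w]) ⟶ ShortComplex.mk g h w :=
    { τ₁ := f, τ₂ := 𝟙 _, τ₃ := 𝟙 _ }
  have : Epi φ.τ₁ := inferInstanceAs (Epi f)
  have : IsIso φ.τ₂ := inferInstanceAs (IsIso (𝟙 _))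
  have : Mono φ.τ₃ := inferInstanceAs (Mono (𝟙 _))
  exact (ShortComplex.exact_iff_of_epi_of_isIso_of_mono φ).2 hgh

theorem exact_comp_mono {X E F G : ModuleCat.{u} R} (f : X ⟶ E) (g : E ⟶ F) (h : F ⟶ G) [Mono h]
    (w : f ≫ g = 0) (hfg : (ShortComplex.mk f g w).Exact) :
    (ShortComplex.mk f (g ≫ h) (by rw [← Category.assoc, w, zero_comp])).Exact := by
  let φ : ShortComplex.mk f g w ⟶
      ShortComplex.mk f (g ≫ h) (by rw [← Category.assoc, w, zero_comp]) :=
    { τ₁ := 𝟙 _, τ₂ := 𝟙 _, τ₃ := h }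
  have : Epi φ.τ₁ := inferInstanceAs (Epi (𝟙 _))
  have : IsIso φ.τ₂ := inferInstanceAs (IsIso (𝟙 _))
  have : Mono φ.τ₃ := inferInstanceAs (Mono h)
  exact (ShortComplex.exact_iff_of_epi_of_isIso_of_mono φ).1 hfg

/-- The complex of injective hulls of the iterated cosyzygies. -/
noncomputable def minimalComplex (X : ModuleCat.{u} R) : CochainComplex (ModuleCat.{u} R) ℕ :=
  CochainComplex.of (fun n => injHull (cosyzygy X n))
    (fun n => toCosyzygy X n ≫ toInjHull (cosyzygy X (n + 1))) (fun n => by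
      rw [Category.assoc, ← Category.assoc (toInjHull _), toInjHull_toCosyzygy, zero_comp,
        comp_zero])

theorem minimalComplex_d (X : ModuleCat.{u} R) (n : ℕ) : (minimalComplex X).d n (n + 1) =
    toCosyzygy X n ≫ toInjHull (cosyzygy X (n + 1)) :=
  CochainComplex.of_d (fun n => injHull (cosyzygy X n))
    (fun n => toCosyzygy X n ≫ toInjHull (cosyzygy X (n + 1))) n

theorem toInjHull_comp_minimalComplex_d (X : ModuleCat.{u} R) (n : ℕ) :
    toInjHull (cosyzygy X n) ≫ (minimalComplex X).d n (n + 1) = 0 :=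
  (congrArg (toInjHull (cosyzygy X n) ≫ ·) (minimalComplex_d X n)).trans
    (show toInjHull (cosyzygy X n) ≫ toCosyzygy X n ≫ toInjHull (cosyzygy X (n + 1)) = 0 by
      rw [← Category.assoc, toInjHull_toCosyzygy, zero_comp])

theorem exact_toInjHull_minimalComplex (X : ModuleCat.{u} R) (n : ℕ) :
    (ShortComplex.mk (toInjHull (cosyzygy X n)) ((minimalComplex X).d n (n + 1))
      (toInjHull_comp_minimalComplex_d X n)).Exact := by
  have h := exact_comp_mono _ _ (toInjHull (cosyzygy X (n + 1))) _ (exact_toCosyzygy X n)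
  simp only [← minimalComplex_d] at h
  exact h

theorem minimalComplex_exactAt_succ (X : ModuleCat.{u} R) (n : ℕ) :
    (minimalComplex X).ExactAt (n + 1) := by
  rw [HomologicalComplex.exactAt_iff' _ n (n + 1) (n + 2) (by simp) (by simp)]
  have h := exact_epi_comp (toCosyzygy X n) _ _ _ (exact_toInjHull_minimalComplex X (n + 1))
  simp only [← minimalComplex_d] at h
  exact h

/-- The minimal injective resolution formed with the chosen injective hulls. -/
noncomputable def minimalResolution (X : ModuleCat.{u} R) : InjectiveResolution X where
  cocomplex := minimalComplex X
  injective n := inferInstanceAs (Injective (injHull (cosyzygy X n)))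
  ι := (CochainComplex.fromSingle₀Equiv _ _).symm
    ⟨toInjHull X, toInjHull_comp_minimalComplex_d X 0⟩
  quasiIso := ⟨fun n => by
    cases n
    · rw [CochainComplex.quasiIsoAt₀_iff, ShortComplex.quasiIso_iff_of_zeros]
      · refine (ShortComplex.exact_and_mono_f_iff_of_iso ?_).2
          ⟨exact_toInjHull_minimalComplex X 0,
            inferInstanceAs (Mono (toInjHull X))⟩
        exact ShortComplex.isoMk (Iso.refl _) (Iso.refl _) (Iso.refl _) (by simp; rfl)
          ((Category.id_comp _).trans (Category.comp_id _).symm)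
      all_goals rfl
    · rw [quasiIsoAt_iff_exactAt]
      · apply minimalComplex_exactAt_succ
      · apply CochainComplex.exactAt_succ_single_obj⟩

theorem isMinimal_minimalResolution (X : ModuleCat.{u} R) : IsMinimal (minimalResolution X) := by
  intro n N hN
  have h : LinearMap.range (toInjHull (cosyzygy X n)).hom =
      LinearMap.ker ((minimalResolution X).cocomplex.d n (n + 1)).hom :=
    (ShortComplex.moduleCat_exact_iff_range_eq_ker _).1 (exact_toInjHull_minimalComplex X n)
  exact isEssential_toInjHull (cosyzygy X n) N ((congrArg (N ⊓ ·) h).trans hN)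

end Hull

section Coresolution

variable {R : Type u} [Ring R]

/-- `X` is the start of an exact sequence `0 → X → E⁰ → ⋯ → Eⁿ⁻¹` with finitely generated
projective-injective terms. -/
def HasDominantCoresolution : ℕ → ModuleCat.{u} R → Prop
  | 0, _ => True
  | n + 1, X => ∃ (E Z : ModuleCat.{u} R) (f : X ⟶ E) (g : E ⟶ Z) (w : f ≫ g = 0),
      (ShortComplex.mk f g w).ShortExact ∧ Injective E ∧ proj R E ∧ HasDominantCoresolution n Z

theorem proj_of_retract {X Y : ModuleCat.{u} R} (h : Retract X Y) (hY : proj R Y) : proj R X := by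
  obtain ⟨h₁, h₂⟩ := hY
  refine ⟨Module.Finite.of_surjective h.r.hom ?_, ?_⟩
  · have : IsSplitEpi h.r := ⟨⟨⟨h.i, h.retract⟩⟩⟩
    exact (ModuleCat.epi_iff_surjective h.r).1 inferInstance
  · exact h.projective

theorem finite_of_epi {X Y : ModuleCat.{u} R} (f : X ⟶ Y) [Epi f] (hX : Module.Finite R X) :
    Module.Finite R Y :=
  Module.Finite.of_surjective f.hom ((ModuleCat.epi_iff_surjective f).1 inferInstance)

theorem finite_of_mono [IsNoetherianRing R] {X Y : ModuleCat.{u} R} (f : X ⟶ Y) [Mono f]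
    (hY : Module.Finite R Y) : Module.Finite R X :=
  Module.Finite.of_injective f.hom ((ModuleCat.mono_iff_injective f).1 inferInstance)

/-- An injective hull is a retract of every injective extension, compatibly with quotients. -/
theorem IsEssential.exists_retract {X X' E E' Z Z' : ModuleCat.{u} R} {f : X ⟶ E} {f' : X' ⟶ E'}
    {g : E ⟶ Z} {g' : E' ⟶ Z'} {w : f ≫ g = 0} {w' : f' ≫ g' = 0} (hf : IsEssential f)
    (hfg : (ShortComplex.mk f g w).ShortExact) (hfg' : (ShortComplex.mk f' g' w').ShortExact)
    [Injective E] [Injective E'] (h : Retract X X') :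
    Nonempty (Retract E E') ∧ Nonempty (Retract Z Z') := by
  have := hfg.mono_f
  have := hfg.epi_g
  have := hfg'.mono_f
  have := hfg'.epi_g
  dsimp only at *
  let a : E ⟶ E' := Injective.factorThru (h.i ≫ f') f
  have ha : f ≫ a = h.i ≫ f' := Injective.comp_factorThru _ _
  let b : E' ⟶ E := Injective.factorThru (h.r ≫ f) f'
  have hb : f' ≫ b = h.r ≫ f := Injective.comp_factorThru _ _
  have hab : f ≫ a ≫ b = f := by
    rw [← Category.assoc, ha, Category.assoc, hb, ← Category.assoc, h.retract, Category.id_comp]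
  have : Mono (f ≫ a ≫ b) := by rw [hab]; infer_instance
  have := hf.mono (a ≫ b)
  let c : E ⟶ E := Injective.factorThru (𝟙 E) (a ≫ b)
  have hc : (a ≫ b) ≫ c = 𝟙 E := Injective.comp_factorThru _ _
  have hfc : f ≫ c = f := by
    conv_lhs => rw [← hab]
    rw [Category.assoc, hc, Category.comp_id]
  have hbc : f' ≫ b ≫ c = h.r ≫ f := by
    rw [← Category.assoc, hb, Category.assoc, hfc]
  refine ⟨⟨⟨a, b ≫ c, by rw [← Category.assoc, hc]⟩⟩, ⟨⟨?_, ?_, ?_⟩⟩⟩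
  · exact hfg.exact.desc (a ≫ g') (by
      dsimp only
      rw [← Category.assoc, ha, Category.assoc, w', comp_zero])
  · exact hfg'.exact.desc ((b ≫ c) ≫ g) (by
      dsimp only
      rw [← Category.assoc, hbc, Category.assoc, w, comp_zero])
  · have h₁ := hfg.exact.g_desc (a ≫ g') (by
      dsimp only
      rw [← Category.assoc, ha, Category.assoc, w', comp_zero])
    have h₂ := hfg'.exact.g_desc ((b ≫ c) ≫ g) (by
      dsimp only
      rw [← Category.assoc, hbc, Category.assoc, w, comp_zero])
    dsimp only at h₁ h₂ ⊢
    rw [← cancel_epi g, ← Category.assoc, h₁, Category.assoc, h₂, ← Category.assoc,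
      ← Category.assoc, hc, Category.id_comp, Category.comp_id]

theorem HasDominantCoresolution.of_retract {n : ℕ} {X X' : ModuleCat.{u} R} (h : Retract X X')
    (hX' : HasDominantCoresolution n X') : HasDominantCoresolution n X := by
  induction n generalizing X X' with
  | zero => trivial
  | succ n ih =>
    obtain ⟨E', Z', f', g', w', hfg', hE', hpE', hZ'⟩ := hX'
    have hfg : (ShortComplex.mk _ _ (cokernel.condition (toInjHull X))).ShortExact :=
      { exact := ShortComplex.exact_cokernel _ }
    obtain ⟨⟨hE⟩, ⟨hZ⟩⟩ := (isEssential_toInjHull X).exists_retract hfg hfg' h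
    exact ⟨_, _, _, _, _, hfg, inferInstance, proj_of_retract hE hpE', ih hZ hZ'⟩

theorem HasDominantCoresolution.cosyzygy {n : ℕ} {X : ModuleCat.{u} R} (i : ℕ)
    (h : HasDominantCoresolution (n + 1) (DomDim.cosyzygy X i)) :
    Projective (injHull (DomDim.cosyzygy X i)) ∧
      HasDominantCoresolution n (DomDim.cosyzygy X (i + 1)) := by
  obtain ⟨E', Z', f', g', w', hfg', hE', hpE', hZ'⟩ := h
  have hfg : (ShortComplex.mk _ _ (toInjHull_toCosyzygy X i)).ShortExact :=
    { exact := exact_toCosyzygy X i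
      mono_f := inferInstanceAs (Mono (toInjHull _))
      epi_g := inferInstanceAs (Epi (toCosyzygy X i)) }
  obtain ⟨⟨hE⟩, ⟨hZ⟩⟩ :=
    (isEssential_toInjHull (DomDim.cosyzygy X i)).exists_retract hfg hfg' (Retract.refl _)
  exact ⟨(proj_of_retract hE hpE').2, hZ'.of_retract hZ⟩

theorem HasDominantCoresolution.le_domDim {n : ℕ} {X : ModuleCat.{u} R}
    (h : HasDominantCoresolution n X) : (n : ℕ∞) ≤ domDim X := by
  have key : ∀ i k, i + k = n → HasDominantCoresolution k (DomDim.cosyzygy X i) := by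
    intro i
    induction i with
    | zero => rintro k hk; obtain rfl : k = n := by lia
              exact h
    | succ i ih => exact fun k hk => ((ih (k + 1) (by lia)).cosyzygy i).2
  refine le_iSup_of_le (minimalResolution X) (le_iSup_of_le (isMinimal_minimalResolution X)
    (le_iSup_of_le n (le_iSup_of_le (fun i hi => ?_) le_rfl)))
  obtain ⟨k, rfl⟩ := Nat.exists_eq_add_of_lt hi
  exact ((key i (k + 1) (by lia)).cosyzygy i).1

/-- An essential extension of a finitely generated module that is projective is finitely
generated. -/
theorem IsEssential.finite [IsNoetherianRing R] {X E : ModuleCat.{u} R} {f : X ⟶ E}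
    (hf : IsEssential f) [Mono f] (hX : Module.Finite R X) [Projective E] : Module.Finite R E := by
  have : Module.Projective R E := (IsProjective.iff_projective E).2 ‹_›
  obtain ⟨s, hs⟩ := Module.projective_def.1 this
  obtain ⟨t, ht⟩ := hX.fg_top
  classical
  let F : Finset E := t.biUnion fun x => (s (f.hom x)).support
  have hF : ∀ x, s (f.hom x) ∈ Finsupp.supported R R (F : Set E) := by
    intro x
    have : Submodule.span R (t : Set X) ≤
        (Finsupp.supported R R (F : Set E)).comap (s ∘ₗ f.hom) := by
      rw [Submodule.span_le]
      intro y hy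
      refine (Finsupp.mem_supported R _).2 ?_
      exact Finset.coe_subset.2 (Finset.subset_biUnion_of_mem (fun x => (s (f.hom x)).support) hy)
    exact this (ht ▸ Submodule.mem_top)
  let ψ : E →ₗ[R] (F →₀ R) := Finsupp.lsubtypeDomain (F : Set E) ∘ₗ s
  have hker : LinearMap.ker ψ = ⊥ := by
    apply hf
    rw [eq_bot_iff]
    rintro _ ⟨hy, x, rfl⟩
    have h0 : s (f.hom x) = 0 := by
      ext y
      by_cases hy' : y ∈ F
      · exact DFunLike.congr_fun (show ψ (f.hom x) = 0 from hy) ⟨y, hy'⟩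
      · exact Finsupp.notMem_support_iff.1 fun h => hy' ((Finsupp.mem_supported R _).1 (hF x) h)
    have := hs (f.hom x)
    rw [h0, map_zero] at this
    simp [← this]
  exact Module.Finite.of_injective ψ (LinearMap.ker_eq_bot.1 hker)

theorem hasDominantCoresolution_of_isMinimal [IsNoetherianRing R] {Y : ModuleCat.{u} R}
    (I : InjectiveResolution Y) (hI : IsMinimal I) {m : ℕ}
    (hm : ∀ i < m, Projective (I.cocomplex.X i)) (k i : ℕ) (hik : i + k ≤ m) {X : ModuleCat.{u} R}
    (hX : Module.Finite R X) (f : X ⟶ I.cocomplex.X i) (hmono : Mono f)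
    (w : f ≫ I.cocomplex.d i (i + 1) = 0) (hf : (ShortComplex.mk _ _ w).Exact) :
    HasDominantCoresolution k X := by
  induction k generalizing i X with
  | zero => trivial
  | succ k ih =>
    have hess : IsEssential f := by
      intro N hN
      refine hI i N ?_
      rw [← hN]
      congr 1
      exact ((ShortComplex.moduleCat_exact_iff_range_eq_ker _).1 hf).symm
    have := hm i (by lia)
    have hfin := hess.finite hX
    let g := cokernel.desc f _ w
    have hg : cokernel.π f ≫ g = I.cocomplex.d i (i + 1) := cokernel.π_desc _ _ _
    have w' : g ≫ I.cocomplex.d (i + 1) (i + 1 + 1) = 0 := by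
      rw [← cancel_epi (cokernel.π f), ← Category.assoc, hg, HomologicalComplex.d_comp_d,
        comp_zero]
    refine ⟨_, _, f, cokernel.π f, cokernel.condition f, { exact := ShortComplex.exact_cokernel _ },
      inferInstance, ⟨hfin, inferInstance⟩, ih (i + 1) (by lia) (finite_of_epi (cokernel.π f) hfin)
      g hf.mono_cokernelDesc w' ?_⟩
    let φ : ShortComplex.mk _ _ (I.cocomplex.d_comp_d i (i + 1) (i + 1 + 1)) ⟶
        ShortComplex.mk g _ w' :=
      { τ₁ := cokernel.π f, τ₂ := 𝟙 _, τ₃ := 𝟙 _, comm₁₂ := by simp [hg] }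
    have : Epi φ.τ₁ := inferInstanceAs (Epi (cokernel.π f))
    have : IsIso φ.τ₂ := inferInstanceAs (IsIso (𝟙 _))
    have : Mono φ.τ₃ := inferInstanceAs (Mono (𝟙 _))
    exact (ShortComplex.exact_iff_of_epi_of_isIso_of_mono φ).1 (I.exact_succ i)

theorem le_domDim_iff [IsNoetherianRing R] {X : ModuleCat.{u} R} (hX : Module.Finite R X) (n : ℕ) :
    (n : ℕ∞) ≤ domDim X ↔ HasDominantCoresolution n X := by
  refine ⟨fun h => ?_, fun h => h.le_domDim⟩
  cases n with
  | zero => trivial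
  | succ n =>
    have h' : (n : ℕ∞) < domDim X := lt_of_lt_of_le (by exact_mod_cast n.lt_succ_self) h
    simp only [domDim, lt_iSup_iff] at h'
    obtain ⟨I, hI, m, hm, hnm⟩ := h'
    have hnm : n < m := by exact_mod_cast hnm
    have hmono : ∀ j, Mono (I.ι.f j) := fun j => inferInstance
    exact hasDominantCoresolution_of_isMinimal I hI hm (n + 1) 0 (by lia) hX (I.ι.f 0)
      (hmono 0) I.ι_f_zero_comp_complex_d I.exact₀

end Coresolution

section Add

variable {R : Type u} [Ring R]

theorem add_iff {M X : ModuleCat.{u} R} :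
    add M X ↔ ∃ (n : ℕ) (a : Fin n → (X ⟶ M)) (b : Fin n → (M ⟶ X)), ∑ j, a j ≫ b j = 𝟙 X := by
  constructor
  · rintro ⟨n, ⟨h⟩⟩
    refine ⟨n, fun j => h.i ≫ ModuleCat.ofHom (LinearMap.proj j),
      fun j => ModuleCat.ofHom (LinearMap.single R (fun _ => M) j) ≫ h.r, ?_⟩
    ext x
    have hx : h.r.hom (h.i.hom x) = x := congrArg (fun f => f.hom x) h.retract
    simp only [ModuleCat.hom_sum, LinearMap.sum_apply, ModuleCat.hom_comp, LinearMap.comp_apply,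
      ModuleCat.hom_ofHom, LinearMap.proj_apply, LinearMap.coe_single, ← map_sum,
      ModuleCat.hom_id, LinearMap.id_apply]
    erw [Finset.univ_sum_single (h.i.hom x)]
    exact hx
  · rintro ⟨n, a, b, hab⟩
    refine ⟨n, ⟨⟨ModuleCat.ofHom (LinearMap.pi fun j => (a j).hom),
      ModuleCat.ofHom (∑ j, (b j).hom ∘ₗ LinearMap.proj j), ?_⟩⟩⟩
    rw [← hab]
    ext x
    simp [ModuleCat.hom_sum, LinearMap.sum_apply]

theorem add_self (M : ModuleCat.{u} R) : add M M :=
  add_iff.2 ⟨1, fun _ => 𝟙 M, fun _ => 𝟙 M, by simp⟩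

theorem add_of_retract {M X Y : ModuleCat.{u} R} (h : Retract X Y) (hY : add M Y) : add M X := by
  obtain ⟨n, ⟨h'⟩⟩ := hY
  exact ⟨n, ⟨h.trans h'⟩⟩

theorem add_trans {M N X : ModuleCat.{u} R} (hMN : add N M) (hX : add M X) : add N X := by
  obtain ⟨n, a, b, hab⟩ := add_iff.1 hX
  obtain ⟨m, c, d, hcd⟩ := add_iff.1 hMN
  let e := finProdFinEquiv (m := n) (n := m)
  refine add_iff.2 ⟨n * m, fun k => a (e.symm k).1 ≫ c (e.symm k).2,
    fun k => d (e.symm k).2 ≫ b (e.symm k).1, ?_⟩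
  rw [← hab, ← e.sum_comp, Fintype.sum_prod_type]
  refine Finset.sum_congr rfl fun i _ => ?_
  simp only [Equiv.symm_apply_apply, Category.assoc]
  have : ∀ j, a i ≫ c j ≫ d j ≫ b i = a i ≫ (c j ≫ d j) ≫ b i := fun j => by simp
  simp only [this, ← Preadditive.comp_sum, ← Preadditive.sum_comp, hcd, Category.id_comp]

theorem add_map {S : Type u} [Ring S] {M X : ModuleCat.{u} R}
    (F : ModuleCat.{u} R ⥤ ModuleCat.{u} S) [F.Additive] (h : add M X) :
    add (F.obj M) (F.obj X) := by
  obtain ⟨n, a, b, hab⟩ := add_iff.1 h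
  refine add_iff.2 ⟨n, fun j => F.map (a j), fun j => F.map (b j), ?_⟩
  simp only [← F.map_comp, ← Functor.map_sum, hab, F.map_id]

theorem finite_of_add {M X : ModuleCat.{u} R} (hM : Module.Finite R M) (h : add M X) :
    Module.Finite R X := by
  obtain ⟨n, ⟨h⟩⟩ := h
  have : IsSplitEpi h.r := ⟨⟨⟨h.i, h.retract⟩⟩⟩
  exact finite_of_epi h.r (inferInstanceAs (Module.Finite R (Fin n → M)))

theorem exists_epi_pi {X : ModuleCat.{u} R} (hX : Module.Finite R X) :
    ∃ (n : ℕ) (f : ModuleCat.of R (Fin n → R) ⟶ X), Epi f := by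
  obtain ⟨n, f, hf⟩ := Module.Finite.exists_fin' R X
  exact ⟨n, ModuleCat.ofHom f, (ModuleCat.epi_iff_surjective _).2 hf⟩

theorem add_pi (M : ModuleCat.{u} R) (n : ℕ) : add M (ModuleCat.of R (Fin n → M)) :=
  ⟨n, ⟨Retract.refl _⟩⟩

theorem proj_iff_add {X : ModuleCat.{u} R} : proj R X ↔ add (ModuleCat.of R R) X := by
  constructor
  · rintro ⟨h₁, h₂⟩
    obtain ⟨n, f, hf⟩ := exists_epi_pi h₁
    exact ⟨n, ⟨⟨Projective.factorThru (𝟙 X) f, f, Projective.factorThru_comp _ _⟩⟩⟩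
  · rintro ⟨n, ⟨h⟩⟩
    refine proj_of_retract h ⟨inferInstanceAs (Module.Finite R (Fin n → R)), ?_⟩
    exact (IsProjective.iff_projective _).1 (inferInstanceAs (Module.Projective R (Fin n → R)))

end Add

section ExtVanishing

variable {R : Type u} [Ring R]

theorem subsingleton_ext_of_add_left {M X Y : ModuleCat.{u} R} {i : ℕ} (hY : add M Y)
    (h : Subsingleton (Ext M X i)) : Subsingleton (Ext Y X i) := by
  obtain ⟨n, a, b, hab⟩ := add_iff.1 hY
  refine subsingleton_of_forall_eq 0 fun e => ?_
  rw [← e.mk₀_id_comp, ← hab, Ext.mk₀_sum, Ext.sum_comp]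
  refine Finset.sum_eq_zero fun j _ => ?_
  rw [← Ext.mk₀_comp_mk₀, Ext.comp_assoc_of_second_deg_zero,
    Subsingleton.elim ((Ext.mk₀ (b j)).comp e (zero_add i)) 0, Ext.comp_zero]

theorem subsingleton_ext_of_add_right {M X Y : ModuleCat.{u} R} {i : ℕ} (hY : add M Y)
    (h : Subsingleton (Ext X M i)) : Subsingleton (Ext X Y i) := by
  obtain ⟨n, a, b, hab⟩ := add_iff.1 hY
  refine subsingleton_of_forall_eq 0 fun e => ?_
  rw [← e.comp_mk₀_id, ← hab, Ext.mk₀_sum, Ext.comp_sum]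
  refine Finset.sum_eq_zero fun j _ => ?_
  rw [← Ext.mk₀_comp_mk₀, ← Ext.comp_assoc_of_second_deg_zero,
    Subsingleton.elim (e.comp (Ext.mk₀ (a j)) (add_zero i)) 0, Ext.zero_comp]

theorem subsingleton_ext_X₁ {C : ShortComplex (ModuleCat.{u} R)} (hC : C.ShortExact)
    (A : ModuleCat.{u} R) {i : ℕ} (h₃ : Subsingleton (Ext A C.X₃ i))
    (h₂ : Subsingleton (Ext A C.X₂ (i + 1))) : Subsingleton (Ext A C.X₁ (i + 1)) := by
  refine subsingleton_of_forall_eq 0 fun e => ?_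
  obtain ⟨x, rfl⟩ := Ext.covariant_sequence_exact₁ A hC e (Subsingleton.elim _ _) rfl
  rw [Subsingleton.elim x 0, Ext.zero_comp]

theorem subsingleton_ext_X₃ {C : ShortComplex (ModuleCat.{u} R)} (hC : C.ShortExact)
    (A : ModuleCat.{u} R) {i : ℕ} (h₂ : Subsingleton (Ext A C.X₂ i))
    (h₁ : Subsingleton (Ext A C.X₁ (i + 1))) : Subsingleton (Ext A C.X₃ i) := by
  refine subsingleton_of_forall_eq 0 fun e => ?_
  obtain ⟨x, rfl⟩ := Ext.covariant_sequence_exact₃ A hC e rfl (Subsingleton.elim _ _)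
  rw [Subsingleton.elim x 0, Ext.zero_comp]

theorem exists_lift_of_subsingleton_ext {C : ShortComplex (ModuleCat.{u} R)} (hC : C.ShortExact)
    {A : ModuleCat.{u} R} (h : Subsingleton (Ext A C.X₁ 1)) (f : A ⟶ C.X₃) :
    ∃ g : A ⟶ C.X₂, g ≫ C.g = f := by
  obtain ⟨x, hx⟩ := Ext.covariant_sequence_exact₃ A hC (Ext.mk₀ f) (zero_add 1)
    (Subsingleton.elim _ _)
  obtain ⟨g, rfl⟩ := Ext.homEquiv₀.symm.surjective x
  exact ⟨g, Ext.homEquiv₀.symm.injective (by simpa using hx)⟩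

theorem subsingleton_ext_one_of_lift {C : ShortComplex (ModuleCat.{u} R)} (hC : C.ShortExact)
    {A : ModuleCat.{u} R} (h₂ : Subsingleton (Ext A C.X₂ 1))
    (h : ∀ f : A ⟶ C.X₃, ∃ g : A ⟶ C.X₂, g ≫ C.g = f) : Subsingleton (Ext A C.X₁ 1) := by
  refine subsingleton_of_forall_eq 0 fun e => ?_
  obtain ⟨x, rfl⟩ := Ext.covariant_sequence_exact₁ A hC e (Subsingleton.elim _ _) (zero_add 1)
  obtain ⟨f, rfl⟩ := Ext.homEquiv₀.symm.surjective x
  obtain ⟨g, rfl⟩ := h f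
  simp [← Ext.mk₀_comp_mk₀, Ext.comp_assoc_of_second_deg_zero]

theorem subsingleton_ext_of_injective (A I : ModuleCat.{u} R) [Injective I] {i : ℕ} (hi : 1 ≤ i) :
    Subsingleton (Ext A I i) := by
  obtain ⟨j, rfl⟩ := Nat.exists_eq_add_of_le' hi
  exact subsingleton_of_forall_eq 0 fun e => e.eq_zero_of_injective

theorem rightPerp_add_iff {M X : ModuleCat.{u} R} {n : ℕ} : rightPerp (add M) n X ↔
    Module.Finite R X ∧ ∀ i, 1 ≤ i → i ≤ n → Subsingleton (Ext M X i) :=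
  ⟨fun h => ⟨h.1, h.2 M (add_self M)⟩, fun h => ⟨h.1, fun _ hY i hi hin =>
    subsingleton_ext_of_add_left hY (h.2 i hi hin)⟩⟩

end ExtVanishing

section GlobalDimension

variable {R : Type u} [Ring R]

theorem glDim_le_iff {n : ℕ} : glDim R ≤ n ↔
    ∀ X : ModuleCat.{u} R, Module.Finite R X → HasProjectiveDimensionLE X n := by
  simp only [glDim, iSup_le_iff, projectiveDimension_le_iff]

/-- The start of a dominant coresolution of length `m` has projective dimension at most `j` if the
global dimension is at most `m + j`. -/
theorem HasDominantCoresolution.hasProjectiveDimensionLE {m j : ℕ} {X : ModuleCat.{u} R}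
    (hX : HasDominantCoresolution m X) (hfin : Module.Finite R X)
    (h : ∀ Y : ModuleCat.{u} R, Module.Finite R Y → HasProjectiveDimensionLE Y (m + j)) :
    HasProjectiveDimensionLE X j := by
  induction m generalizing j X with
  | zero => simpa using h X hfin
  | succ m ih =>
    obtain ⟨E, Z, f, g, w, hfg, hE, ⟨hE₁, hE₂⟩, hZ⟩ := hX
    have := hfg.epi_g
    have hZ' := ih (j := j + 1) hZ (finite_of_epi g hE₁)
      (by simpa only [add_assoc, add_comm 1 j] using h)
    exact hfg.hasProjectiveDimensionLT_X₁ (j + 1)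
      (hasProjectiveDimensionLT_of_ge E 1 (j + 1) (by lia)) hZ'

theorem projective_of_injective_self [IsNoetherianRing R]
    (hR : Injective (ModuleCat.of R R)) {m : ℕ} {X : ModuleCat.{u} R}
    (hX : Module.Finite R X) (h : HasProjectiveDimensionLE X m) :
    Projective X := by
  induction m generalizing X with
  | zero => exact projective_iff_hasProjectiveDimensionLT_one.2 h
  | succ m ih =>
    obtain ⟨n, f, hf⟩ := exists_epi_pi hX
    have hP : proj R (ModuleCat.of R (Fin n → R)) := proj_iff_add.2 (add_pi _ n)
    have hC : (ShortComplex.mk _ _ (kernel.condition f)).ShortExact :=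
      { exact := ShortComplex.exact_kernel f }
    have := hP.2
    have hfin := finite_of_mono (kernel.ι f) hP.1
    have hK : Projective (kernel f) := ih hfin
      (hC.hasProjectiveDimensionLT_X₁ (m + 1)
        (hasProjectiveDimensionLT_of_ge _ 1 (m + 1) (by lia)) h)
    have hinj : Injective (kernel f) := by
      obtain ⟨k, ⟨r⟩⟩ := proj_iff_add.1 ⟨hfin, hK⟩
      have : Injective (ModuleCat.of R (Fin k → R)) := by
        have : Module.Injective R R := (Module.injective_iff_injective_object R R).2 hR
        exact (Module.injective_iff_injective_object R _).1 inferInstance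
      exact r.injective
    exact (Retract.mk (hC.splittingOfInjective.s) f (hC.splittingOfInjective.s_g)).projective

end GlobalDimension
/-- A fully faithful functor `F` with exact left adjoint `T` that sends the finitely generated
module `M` to the regular module, where every finitely generated module embeds into an injective
module in `add M`. The model case is `Hom(M, -)` for a generator-cogenerator `M`. -/
structure HomContext {R : Type u} [Ring R] (M : ModuleCat.{u} R) (S : Type u) [Ring S] where
  /-- the functor `Hom(M, -)` -/
  F : ModuleCat.{u} R ⥤ ModuleCat.{u} S
  /-- its exact left adjoint -/
  T : ModuleCat.{u} S ⥤ ModuleCat.{u} R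
  /-- the adjunction -/
  adj : T ⊣ F
  full : F.Full
  faithful : F.Faithful
  additive : F.Additive
  preservesInjectiveObjects : F.PreservesInjectiveObjects
  preservesFiniteLimits : PreservesFiniteLimits T
  /-- `M` corresponds to the regular module -/
  isoM : F.obj M ≅ ModuleCat.of S S
  finite : Module.Finite R M
  exists_injective : ∀ X : ModuleCat.{u} R, Module.Finite R X →
    ∃ (I : ModuleCat.{u} R) (f : X ⟶ I), Mono f ∧ Injective I ∧ add M I

namespace HomContext

variable {R : Type u} [Ring R] {M : ModuleCat.{u} R} {S : Type u} [Ring S] (c : HomContext M S)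

attribute [instance] full faithful additive preservesInjectiveObjects preservesFiniteLimits

instance : c.T.Additive := c.adj.left_adjoint_additive
instance : c.F.IsRightAdjoint := c.adj.isRightAdjoint
instance : c.T.IsLeftAdjoint := c.adj.isLeftAdjoint
instance : PreservesLimitsOfSize.{0, 0} c.F := c.adj.rightAdjoint_preservesLimits
instance : PreservesColimitsOfSize.{0, 0} c.T := c.adj.leftAdjoint_preservesColimits
instance : PreservesFiniteColimits c.T := PreservesColimitsOfSize.preservesFiniteColimits _
instance : PreservesFiniteLimits c.F := PreservesLimitsOfSize.preservesFiniteLimits _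

/-- The unit of the adjunction. -/
def η (Y : ModuleCat.{u} S) : Y ⟶ c.F.obj (c.T.obj Y) := c.adj.unit.app Y

theorem η_naturality {Y Y' : ModuleCat.{u} S} (f : Y ⟶ Y') :
    c.η Y ≫ c.F.map (c.T.map f) = f ≫ c.η Y' :=
  (c.adj.unit.naturality f).symm

instance isIso_η (X : ModuleCat.{u} R) : IsIso (c.η (c.F.obj X)) :=
  IsIso.of_isIso_fac_right (c.adj.right_triangle_components X)

/-- The counit is an isomorphism. -/
noncomputable def ε (X : ModuleCat.{u} R) : c.T.obj (c.F.obj X) ≅ X :=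
  asIso (c.adj.counit.app X)

theorem isIso_η_of_add {X : ModuleCat.{u} R} {Y : ModuleCat.{u} S} (h : add (c.F.obj X) Y) :
    IsIso (c.η Y) := by
  obtain ⟨n, a, b, hab⟩ := add_iff.1 h
  refine ⟨∑ j, c.F.map (c.T.map (a j)) ≫ inv (c.η (c.F.obj X)) ≫ b j, ?_, ?_⟩
  · rw [Preadditive.comp_sum, ← hab]
    refine Finset.sum_congr rfl fun j _ => ?_
    rw [← Category.assoc, η_naturality, Category.assoc, IsIso.hom_inv_id_assoc]
  · have (j : Fin n) : (c.F.map (c.T.map (a j)) ≫ inv (c.η (c.F.obj X)) ≫ b j) ≫ c.η Y =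
        c.F.map (c.T.map (a j ≫ b j)) := by
      rw [Category.assoc, Category.assoc, ← η_naturality, IsIso.inv_hom_id_assoc,
        Functor.map_comp, Functor.map_comp]
    rw [Preadditive.sum_comp, Finset.sum_congr rfl fun j _ => this j, ← Functor.map_sum,
      ← Functor.map_sum, hab, CategoryTheory.Functor.map_id, CategoryTheory.Functor.map_id]

theorem add_obj_of_proj {Y : ModuleCat.{u} S} (h : proj S Y) : add (c.F.obj M) Y := by
  refine add_trans (add_of_retract c.isoM.symm.retract (add_self _)) (proj_iff_add.1 h)

theorem isIso_η_of_proj {Y : ModuleCat.{u} S} (h : proj S Y) : IsIso (c.η Y) :=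
  c.isIso_η_of_add (c.add_obj_of_proj h)

theorem add_T_of_proj {Y : ModuleCat.{u} S} (h : proj S Y) : add M (c.T.obj Y) :=
  add_trans (add_of_retract (c.ε M).retract (add_self _)) (add_map c.T (c.add_obj_of_proj h))

theorem proj_F_iff {X : ModuleCat.{u} R} : proj S (c.F.obj X) ↔ add M X := by
  constructor
  · exact fun h => add_of_retract (c.ε X).symm.retract (c.add_T_of_proj h)
  · exact fun h => proj_iff_add.2
      (add_trans (add_of_retract c.isoM.retract (add_self _)) (add_map c.F h))

theorem finite_T {Y : ModuleCat.{u} S} (h : Module.Finite S Y) : Module.Finite R (c.T.obj Y) := by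
  obtain ⟨n, f, hf⟩ := exists_epi_pi h
  exact finite_of_epi (c.T.map f)
    (finite_of_add c.finite (c.add_T_of_proj (proj_iff_add.2 (add_pi _ n))))

theorem finite_F [IsNoetherianRing S] {X : ModuleCat.{u} R} (h : Module.Finite R X) :
    Module.Finite S (c.F.obj X) := by
  obtain ⟨I, f, hf, -, hI⟩ := c.exists_injective X h
  exact finite_of_mono (c.F.map f) (c.proj_F_iff.2 hI).1

theorem finite_F_iff [IsNoetherianRing S] {X : ModuleCat.{u} R} :
    Module.Finite S (c.F.obj X) ↔ Module.Finite R X :=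
  ⟨fun h => finite_of_epi (c.ε X).hom (c.finite_T h), c.finite_F⟩

theorem exists_approximation [IsNoetherianRing S] {X : ModuleCat.{u} R} (h : Module.Finite R X) :
    ∃ (N : ModuleCat.{u} R) (p : N ⟶ X), add M N ∧ Epi p ∧ Epi (c.F.map p) := by
  obtain ⟨n, f, hf⟩ := exists_epi_pi (c.finite_F h)
  refine ⟨_, c.T.map f ≫ (c.ε X).hom, c.add_T_of_proj (proj_iff_add.2 (add_pi _ n)),
    inferInstance, ?_⟩
  have : c.η _ ≫ c.F.map (c.T.map f ≫ (c.ε X).hom) = f := by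
    rw [Functor.map_comp, ← Category.assoc, η_naturality, Category.assoc]
    erw [c.adj.right_triangle_components X]
    exact Category.comp_id f
  have : Epi (c.η _ ≫ c.F.map (c.T.map f ≫ (c.ε X).hom)) := by rwa [this]
  exact epi_of_epi (c.η _) _

theorem epi_F_map_iff {X Y : ModuleCat.{u} R} (g : X ⟶ Y) :
    Epi (c.F.map g) ↔ ∀ f : M ⟶ Y, ∃ f' : M ⟶ X, f' ≫ g = f := by
  constructor
  · intro h f
    have : Projective (c.F.obj M) := (c.proj_F_iff.2 (add_self M)).2
    refine ⟨c.F.preimage (Projective.factorThru (c.F.map f) (c.F.map g)), c.F.map_injective ?_⟩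
    rw [Functor.map_comp, Functor.map_preimage, Projective.factorThru_comp]
  · intro h
    rw [ModuleCat.epi_iff_surjective]
    intro y
    let φ : ModuleCat.of S S ⟶ c.F.obj Y := ModuleCat.ofHom (LinearMap.toSpanSingleton S _ y)
    obtain ⟨f', hf'⟩ := h (c.F.preimage (c.isoM.hom ≫ φ))
    have h1 : c.isoM.inv ≫ c.F.map f' ≫ c.F.map g = φ := by
      rw [← Functor.map_comp, hf', Functor.map_preimage, Iso.inv_hom_id_assoc]
    refine ⟨(c.isoM.inv ≫ c.F.map f').hom (1 : S), ?_⟩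
    have h2 : (c.isoM.inv ≫ c.F.map f' ≫ c.F.map g).hom (1 : S) = φ.hom (1 : S) := by rw [h1]
    simpa [φ] using h2

theorem epi_F_map_iff_ext {C : ShortComplex (ModuleCat.{u} R)} (hC : C.ShortExact)
    (h : Subsingleton (Ext M C.X₂ 1)) : Epi (c.F.map C.g) ↔ Subsingleton (Ext M C.X₁ 1) := by
  rw [epi_F_map_iff]
  exact ⟨subsingleton_ext_one_of_lift hC h, exists_lift_of_subsingleton_ext hC⟩

theorem shortExact_F {C : ShortComplex (ModuleCat.{u} R)} (hC : C.ShortExact)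
    (h : Epi (c.F.map C.g)) : (C.map c.F).ShortExact := by
  have := hC.mono_f
  exact
    { exact := hC.exact.map_of_mono_of_preservesKernel c.F hC.mono_f inferInstance
      mono_f := inferInstanceAs (Mono (c.F.map C.f))
      epi_g := h }

theorem shortExact_T {C : ShortComplex (ModuleCat.{u} S)} (hC : C.ShortExact) :
    (C.map c.T).ShortExact := hC.map_of_exact c.T

theorem hasDominantCoresolution_F {n : ℕ} {X : ModuleCat.{u} R} (hX : Module.Finite R X)
    (h : ∀ i, 1 ≤ i → i ≤ n → Subsingleton (Ext M X i)) :
    HasDominantCoresolution (n + 2) (c.F.obj X) := by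
  obtain ⟨I, f, hf, hI, hI'⟩ := c.exists_injective X hX
  have hC : (ShortComplex.mk _ _ (cokernel.condition f)).ShortExact :=
    { exact := ShortComplex.exact_cokernel f }
  have hfin := finite_of_epi (cokernel.π f) (finite_of_add c.finite hI')
  have hFI : Injective (c.F.obj I) := c.F.injective_obj I
  induction n generalizing X I with
  | zero =>
    obtain ⟨J, g, hg, hJ, hJ'⟩ := c.exists_injective _ hfin
    have hFJ : Injective (c.F.obj J) := c.F.injective_obj J
    have w : c.F.map f ≫ c.F.map (cokernel.π f) = 0 := by
      rw [← Functor.map_comp, cokernel.condition, Functor.map_zero]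
    have hex : (ShortComplex.mk _ _ w).Exact :=
      hC.exact.map_of_mono_of_preservesKernel c.F hf inferInstance
    have : Mono (cokernel.desc (c.F.map f) _ w) := hex.mono_cokernelDesc
    have hmono : Mono (cokernel.desc (c.F.map f) _ w ≫ c.F.map g) := inferInstance
    exact ⟨_, _, c.F.map f, cokernel.π _, cokernel.condition _,
      { exact := ShortComplex.exact_cokernel _ }, hFI, c.proj_F_iff.2 hI', _, _,
      cokernel.desc (c.F.map f) _ w ≫ c.F.map g, cokernel.π _, cokernel.condition _,
      { exact := ShortComplex.exact_cokernel _ }, hFJ, c.proj_F_iff.2 hJ', trivial⟩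
  | succ n ih =>
    have hepi := (c.epi_F_map_iff_ext hC (subsingleton_ext_of_injective M I le_rfl)).2
      (h 1 le_rfl (by lia))
    refine ⟨_, _, _, _, _, c.shortExact_F hC hepi, hFI, c.proj_F_iff.2 hI', ?_⟩
    obtain ⟨J, g, hg, hJ, hJ'⟩ := c.exists_injective _ hfin
    refine ih hfin (fun i hi hin => ?_) J g hg hJ hJ' { exact := ShortComplex.exact_cokernel g }
      (finite_of_epi (cokernel.π g) (finite_of_add c.finite hJ')) (c.F.injective_obj J)
    exact subsingleton_ext_X₃ hC M (subsingleton_ext_of_injective M I hi)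
      (h (i + 1) (by lia) (by lia))

theorem injective_T [IsNoetherianRing S] {E : ModuleCat.{u} S} (hE : Injective E)
    (hE' : proj S E) : Injective (c.T.obj E) := by
  obtain ⟨J, j, hj, hJ, -⟩ := c.exists_injective _ (c.finite_T hE'.1)
  have := c.isIso_η_of_proj hE'
  have hinj : Injective (c.F.obj (c.T.obj E)) := Injective.of_iso (asIso (c.η E)) hE
  have hr : j ≫ c.F.preimage (Injective.factorThru (𝟙 _) (c.F.map j)) = 𝟙 _ :=
    c.F.map_injective (by
      rw [Functor.map_comp, Functor.map_preimage, Injective.comp_factorThru,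
        CategoryTheory.Functor.map_id])
  exact (Retract.mk j _ hr).injective

theorem mono_η_of_mono {Y E : ModuleCat.{u} S} (f : Y ⟶ E) [Mono f] (h : IsIso (c.η E)) :
    Mono (c.η Y) := by
  have : Mono (c.η Y ≫ c.F.map (c.T.map f)) := by
    rw [c.η_naturality]
    infer_instance
  exact mono_of_mono _ (c.F.map (c.T.map f))

theorem isIso_η_of_shortExact {C : ShortComplex (ModuleCat.{u} S)} (hC : C.ShortExact)
    (h₂ : IsIso (c.η C.X₂)) (h₃ : Mono (c.η C.X₃)) : IsIso (c.η C.X₁) := by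
  have := hC.mono_f
  have h₁ := c.mono_η_of_mono C.f h₂
  have hm : Mono (c.F.map (c.T.map C.f)) := inferInstance
  have : Epi (c.η C.X₁) := by
    rw [ModuleCat.epi_iff_surjective]
    intro y
    obtain ⟨e, he⟩ := (ModuleCat.epi_iff_surjective (c.η C.X₂)).1 inferInstance
      ((c.F.map (c.T.map C.f)).hom y)
    have h0 : (c.η C.X₃).hom (C.g.hom e) = 0 := by
      rw [← LinearMap.comp_apply, ← ModuleCat.hom_comp, ← η_naturality, ModuleCat.hom_comp,
        LinearMap.comp_apply]
      erw [he]
      rw [← LinearMap.comp_apply, ← ModuleCat.hom_comp, ← Functor.map_comp, ← Functor.map_comp,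
        C.zero, Functor.map_zero, Functor.map_zero]
      rfl
    have h0' : C.g.hom e = 0 :=
      (ModuleCat.mono_iff_injective (c.η C.X₃)).1 h₃ (h0.trans (map_zero _).symm)
    obtain ⟨x, rfl⟩ := (ShortComplex.moduleCat_exact_iff _).1 hC.exact e h0'
    refine ⟨x, (ModuleCat.mono_iff_injective _).1 hm ?_⟩
    have := congrArg (fun k => k.hom x) (c.η_naturality C.f)
    exact this.trans he
  exact isIso_of_mono_of_epi _

theorem mono_η {n : ℕ} {Y : ModuleCat.{u} S} (h : HasDominantCoresolution (n + 1) Y) :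
    Mono (c.η Y) := by
  obtain ⟨E, Z, f, g, w, hfg, hE, hE', hZ⟩ := h
  have : Mono f := hfg.mono_f
  exact c.mono_η_of_mono f (c.isIso_η_of_proj hE')

theorem isIso_η_of_coresolution {n : ℕ} {Y : ModuleCat.{u} S}
    (h : HasDominantCoresolution (n + 2) Y) : IsIso (c.η Y) := by
  obtain ⟨E, Z, f, g, w, hfg, hE, hE', hZ⟩ := h
  exact c.isIso_η_of_shortExact hfg (c.isIso_η_of_proj hE') (c.mono_η hZ)

theorem subsingleton_ext_T [IsNoetherianRing S] {n : ℕ} {Y : ModuleCat.{u} S}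
    (h : HasDominantCoresolution (n + 2) Y) (i : ℕ) (hi : 1 ≤ i) (hin : i ≤ n) :
    Subsingleton (Ext M (c.T.obj Y) i) := by
  induction n generalizing Y i with
  | zero => lia
  | succ n ih =>
    obtain ⟨E, Z, f, g, w, hfg, hE, hE', hZ⟩ := h
    have hTE := c.injective_T hE hE'
    have hT := c.shortExact_T hfg
    obtain ⟨i, rfl⟩ := Nat.exists_eq_add_of_le' hi
    rcases Nat.eq_zero_or_pos i with rfl | hi'
    · refine (c.epi_F_map_iff_ext hT (subsingleton_ext_of_injective M (c.T.obj E) le_rfl)).1 ?_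
      have := c.isIso_η_of_coresolution hZ
      have : Epi g := hfg.epi_g
      have : Epi (c.η E ≫ c.F.map (c.T.map g)) := by
        rw [c.η_naturality]
        infer_instance
      exact epi_of_epi (c.η E) (c.F.map (c.T.map g))
    · exact subsingleton_ext_X₁ hT M (ih hZ i hi' (by lia))
        (subsingleton_ext_of_injective M (c.T.obj E) (by lia))

end HomContext
theorem Dom_of_iso {S : Type u} [Ring S] [IsNoetherianRing S] {X Y : ModuleCat.{u} S} {d : ℕ}
    (e : X ≅ Y) (h : Dom S d X) : Dom S d Y :=
  ⟨finite_of_epi e.hom h.1,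
    (((le_domDim_iff h.1 d).1 h.2).of_retract e.symm.retract).le_domDim⟩

theorem subsingleton_ext_self {R : Type u} [Ring R] {M : ModuleCat.{u} R} {n : ℕ}
    (h : add M = rightPerp (add M) n) (i : ℕ) (hi : 1 ≤ i) (hin : i ≤ n) :
    Subsingleton (Ext M M i) := by
  have hM : rightPerp (add M) n M := h ▸ add_self M
  exact hM.2 M (add_self M) i hi hin

namespace HomContext

variable {R : Type u} [Ring R] {M : ModuleCat.{u} R} {S : Type u} [Ring S] [IsNoetherianRing S]

theorem Dom_F_iff (c : HomContext M S) {n : ℕ} {X : ModuleCat.{u} R} :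
    Dom S (n + 2) (c.F.obj X) ↔ rightPerp (add M) n X := by
  rw [rightPerp_add_iff]
  constructor
  · rintro ⟨h₁, h₂⟩
    refine ⟨c.finite_F_iff.1 h₁, fun i hi hin => ?_⟩
    exact subsingleton_ext_of_add_right (add_of_retract (c.ε X).symm.retract (add_self _))
      (c.subsingleton_ext_T ((le_domDim_iff h₁ (n + 2)).1 h₂) i hi hin)
  · rintro ⟨h₁, h₂⟩
    exact ⟨c.finite_F h₁, (c.hasDominantCoresolution_F h₁ h₂).le_domDim⟩

theorem proj_eq_Dom_iff (c : HomContext M S) {n : ℕ} :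
    proj S = Dom S (n + 2) ↔ add M = rightPerp (add M) n := by
  constructor
  · intro h
    ext X
    rw [← c.proj_F_iff, h, c.Dom_F_iff]
  · intro h
    ext Y
    constructor
    · intro hY
      have := c.isIso_η_of_proj hY
      refine Dom_of_iso (asIso (c.η Y)).symm (c.Dom_F_iff.2 ?_)
      rw [← h]
      exact c.add_T_of_proj hY
    · intro hY
      have := c.isIso_η_of_coresolution ((le_domDim_iff hY.1 (n + 2)).1 hY.2)
      refine proj_of_retract (asIso (c.η Y)).retract (c.proj_F_iff.2 ?_)
      rw [h, ← c.Dom_F_iff]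
      exact Dom_of_iso (asIso (c.η Y)) hY

/-- A short exact sequence with middle term in `add M` that stays exact under `F`. -/
theorem exists_shortExact (c : HomContext M S) {j n : ℕ}
    (hM : ∀ i, 1 ≤ i → i ≤ n → Subsingleton (Ext M M i)) (hjn : j < n) [IsNoetherianRing R]
    {X : ModuleCat.{u} R} (hX : Module.Finite R X)
    (h : ∀ i, 1 ≤ i → i ≤ j → Subsingleton (Ext M X i)) :
    ∃ (X' N : ModuleCat.{u} R) (f : X' ⟶ N) (p : N ⟶ X) (w : f ≫ p = 0),
      (ShortComplex.mk f p w).ShortExact ∧ Epi (c.F.map p) ∧ add M N ∧ Module.Finite R X' ∧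
      ∀ i, 1 ≤ i → i ≤ j + 1 → Subsingleton (Ext M X' i) := by
  obtain ⟨N, p, hN, hp, hFp⟩ := c.exists_approximation hX
  have hC : (ShortComplex.mk _ _ (kernel.condition p)).ShortExact :=
    { exact := ShortComplex.exact_kernel p }
  refine ⟨_, N, _, p, _, hC, hFp, hN, finite_of_mono (kernel.ι p) (finite_of_add c.finite hN),
    fun i hi hij => ?_⟩
  have hMN : ∀ i, 1 ≤ i → i ≤ n → Subsingleton (Ext M N i) := fun i hi hin =>
    subsingleton_ext_of_add_right hN (hM i hi hin)
  obtain ⟨i, rfl⟩ := Nat.exists_eq_add_of_le' hi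
  rcases Nat.eq_zero_or_pos i with rfl | hi'
  · exact (c.epi_F_map_iff_ext hC (hMN 1 le_rfl (by lia))).1 hFp
  · exact subsingleton_ext_X₁ hC M (h i hi' (by lia)) (hMN (i + 1) (by lia) (by lia))

section MaximalOrthogonal

variable [IsNoetherianRing R] {n : ℕ}

theorem hasProjectiveDimensionLE_F (c : HomContext M S) (h : add M = rightPerp (add M) n) (k j : ℕ)
    (hjk : j + k = n) {X : ModuleCat.{u} R} (hX : Module.Finite R X)
    (hj : ∀ i, 1 ≤ i → i ≤ j → Subsingleton (Ext M X i)) :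
    HasProjectiveDimensionLE (c.F.obj X) k := by
  induction k generalizing j X with
  | zero =>
    obtain rfl : j = n := by lia
    have hX' : add M X := by
      rw [h]
      exact rightPerp_add_iff.2 ⟨hX, hj⟩
    exact projective_iff_hasProjectiveDimensionLT_one.1 (c.proj_F_iff.2 hX').2
  | succ k ih =>
    obtain ⟨X', N, f, p, w, hfp, hFp, hN, hX', hj'⟩ :=
      c.exists_shortExact (subsingleton_ext_self h) (by lia) hX hj
    have := (c.proj_F_iff.2 hN).2
    exact (c.shortExact_F hfp hFp).hasProjectiveDimensionLT_X₃ (k + 1) (ih (j + 1) (by lia) hX' hj')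
      (hasProjectiveDimensionLT_of_ge (c.F.obj N) 1 (k + 2) (by lia))

theorem hasProjectiveDimensionLE (c : HomContext M S) (h : add M = rightPerp (add M) n)
    {Y : ModuleCat.{u} S} (hY : Module.Finite S Y) : HasProjectiveDimensionLE Y (n + 2) := by
  obtain ⟨k₀, p₀, hp₀⟩ := exists_epi_pi hY
  have hP₀ : proj S (ModuleCat.of S (Fin k₀ → S)) := proj_iff_add.2 (add_pi _ k₀)
  have hK := finite_of_mono (kernel.ι p₀) hP₀.1
  obtain ⟨k₁, p₁, hp₁⟩ := exists_epi_pi hK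
  have hP₁ : proj S (ModuleCat.of S (Fin k₁ → S)) := proj_iff_add.2 (add_pi _ k₁)
  have hL := finite_of_mono (kernel.ι p₁) hP₁.1
  have hC₀ : (ShortComplex.mk _ _ (kernel.condition p₀)).ShortExact :=
    { exact := ShortComplex.exact_kernel p₀ }
  have hC₁ : (ShortComplex.mk _ _ (kernel.condition p₁)).ShortExact :=
    { exact := ShortComplex.exact_kernel p₁ }
  have hη := c.isIso_η_of_shortExact hC₁ (c.isIso_η_of_proj hP₁)
    (c.mono_η_of_mono (kernel.ι p₀) (c.isIso_η_of_proj hP₀))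
  dsimp only at hη
  have hpdF := c.hasProjectiveDimensionLE_F h n 0 (by lia) (c.finite_T hL) (by lia)
  have hpdL := hasProjectiveDimensionLT_of_iso (asIso (c.η (kernel p₁))).symm (n + 1)
  have := hP₀.2
  have := hP₁.2
  have hpdK := hC₁.hasProjectiveDimensionLT_X₃ (n + 1) hpdL
    (hasProjectiveDimensionLT_of_ge _ 1 (n + 2) (by lia))
  exact hC₀.hasProjectiveDimensionLT_X₃ (n + 2) hpdK
    (hasProjectiveDimensionLT_of_ge _ 1 (n + 3) (by lia))

theorem subsingleton_ext_of_leftPerp (c : HomContext M S) (h : add M = rightPerp (add M) n)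
    {W : ModuleCat.{u} R} (hW : leftPerp (add M) n W) (k j : ℕ) (hjk : j + k = n)
    {X : ModuleCat.{u} R} (hX : Module.Finite R X)
    (hj : ∀ i, 1 ≤ i → i ≤ j → Subsingleton (Ext M X i)) (i : ℕ)
    (hi : 1 ≤ i) (hij : i ≤ j) : Subsingleton (Ext W X i) := by
  induction k generalizing j X i with
  | zero =>
    obtain rfl : j = n := by lia
    have hX' : add M X := by
      rw [h]
      exact rightPerp_add_iff.2 ⟨hX, hj⟩
    exact hW.2 X hX' i hi hij
  | succ k ih =>
    obtain ⟨X', N, f, p, w, hfp, hFp, hN, hX', hj'⟩ :=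
      c.exists_shortExact (subsingleton_ext_self h) (by lia) hX hj
    exact subsingleton_ext_X₃ hfp W (hW.2 N hN i hi (by lia))
      (ih (j + 1) (by lia) hX' hj' (i + 1) (by lia) (by lia))

theorem add_eq_leftPerp (c : HomContext M S) (h : add M = rightPerp (add M) n) :
    add M = leftPerp (add M) n := by
  ext X
  constructor
  · intro hX
    exact ⟨finite_of_add c.finite hX, fun Y hY i hi hin => subsingleton_ext_of_add_left hX
      (subsingleton_ext_of_add_right hY (subsingleton_ext_self h i hi hin))⟩
  · intro hX
    rcases Nat.eq_zero_or_pos n with rfl | hn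
    · rw [h]
      exact rightPerp_add_iff.2 ⟨hX.1, by lia⟩
    · obtain ⟨X', N, f, p, w, hfp, hFp, hN, hX', hj'⟩ :=
        c.exists_shortExact (subsingleton_ext_self h) hn hX.1 (by lia)
      obtain ⟨s, hs⟩ := exists_lift_of_subsingleton_ext hfp
        (c.subsingleton_ext_of_leftPerp h hX (n - 1) 1 (by lia) hX' hj' 1 le_rfl le_rfl) (𝟙 X)
      exact add_of_retract ⟨s, p, hs⟩ hN

end MaximalOrthogonal

/-- `R` is semisimple if all finitely generated `S`-modules are projective. -/
theorem isSemisimpleRing (c : HomContext M S) [IsNoetherianRing R]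
    (h : ∀ Y : ModuleCat.{u} S, Module.Finite S Y → Projective Y) : IsSemisimpleRing R := by
  refine { exists_isCompl := fun J => ?_ }
  let j : ModuleCat.of R J ⟶ ModuleCat.of R R := ModuleCat.ofHom J.subtype
  have hj : Mono j := (ModuleCat.mono_iff_injective _).2 J.injective_subtype
  have hC : (ShortComplex.mk _ _ (cokernel.condition (c.F.map j))).ShortExact :=
    { exact := ShortComplex.exact_cokernel _ }
  have hfin : Module.Finite R (ModuleCat.of R R) := inferInstanceAs (Module.Finite R R)
  have := h _ (finite_of_epi (cokernel.π (c.F.map j)) (c.finite_F hfin))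
  let σ := hC.splittingOfProjective
  have hr : j ≫ c.F.preimage σ.r = 𝟙 _ := c.F.map_injective (by
    rw [Functor.map_comp, Functor.map_preimage, CategoryTheory.Functor.map_id]
    exact σ.f_r)
  have hr' : ∀ x : J, (c.F.preimage σ.r).hom (x : R) = x := fun x =>
    congrArg (fun k => k.hom x) hr
  exact ⟨_, LinearMap.isCompl_of_proj hr'⟩

theorem isSemisimpleRing_of_hasDominantCoresolution (c : HomContext M S) [IsNoetherianRing R]
    {m : ℕ} (h₁ : HasDominantCoresolution (m + 1) (ModuleCat.of S S)) (h₂ : glDim S ≤ m) :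
    IsSemisimpleRing R := by
  rw [glDim_le_iff] at h₂
  refine c.isSemisimpleRing fun Y hY => ?_
  refine projective_of_injective_self ?_ hY (h₂ Y hY)
  obtain ⟨E, Z, f, g, w, hfg, hE, hE', hZ⟩ := h₁
  have := hfg.epi_g
  have hZ' : HasProjectiveDimensionLE Z 0 :=
    hZ.hasProjectiveDimensionLE (finite_of_epi g hE'.1) (by simpa using h₂)
  have : Projective Z := projective_iff_hasProjectiveDimensionLT_one.2 hZ'
  let σ := hfg.splittingOfProjective
  exact (Retract.mk f σ.r σ.f_r).injective

theorem tfae (c : HomContext M S) [IsNoetherianRing R] (hR : ¬ IsSemisimpleRing R) (n : ℕ) :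
    List.TFAE
      [proj S = Dom S (n + 2),
        domDim (ModuleCat.of S S) = ((n + 2 : ℕ) : ℕ∞) ∧ glDim S = ((n + 2 : ℕ) : WithBot ℕ∞),
        IsMaximalOrthogonal M n] := by
  have hfin : Module.Finite S (ModuleCat.of S S) := inferInstanceAs (Module.Finite S S)
  tfae_have 1 ↔ 3 := by
    rw [c.proj_eq_Dom_iff]
    exact ⟨fun h => ⟨h, c.add_eq_leftPerp h⟩, fun h => h.1⟩
  tfae_have 1 → 2 := by
    intro h
    have hgl : glDim S ≤ ((n + 2 : ℕ) : WithBot ℕ∞) :=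
      glDim_le_iff.2 fun Y hY => c.hasProjectiveDimensionLE (c.proj_eq_Dom_iff.1 h) hY
    have hdom : Dom S (n + 2) (ModuleCat.of S S) := by
      rw [← h]
      exact proj_iff_add.2 (add_self _)
    constructor
    · refine le_antisymm (not_lt.1 fun hlt => hR ?_) hdom.2
      refine c.isSemisimpleRing_of_hasDominantCoresolution (m := n + 2)
        ((le_domDim_iff hfin _).1 ?_) hgl
      exact_mod_cast Order.add_one_le_of_lt hlt
    · refine le_antisymm hgl (not_lt.1 fun hlt => hR ?_)
      refine c.isSemisimpleRing_of_hasDominantCoresolution (m := n + 1)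
        ((le_domDim_iff hfin _).1 hdom.2) ?_
      rw [← ENat.WithBot.lt_add_one_iff]
      exact_mod_cast hlt
  tfae_have 2 → 1 := by
    rintro ⟨hdom, hgl⟩
    rw [c.proj_eq_Dom_iff]
    have hS := (le_domDim_iff hfin (n + 2)).1 hdom.ge
    ext X
    rw [rightPerp_add_iff]
    constructor
    · intro hX
      refine ⟨finite_of_add c.finite hX, fun i hi hin => subsingleton_ext_of_add_right
        (add_trans ?_ hX) (c.subsingleton_ext_T hS i hi hin)⟩
      have e : c.T.obj (ModuleCat.of S S) ≅ M := (c.T.mapIso c.isoM).symm ≪≫ c.ε M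
      exact add_of_retract e.symm.retract (add_self _)
    · rintro ⟨hX, hX'⟩
      refine c.proj_F_iff.1 ⟨c.finite_F hX, ?_⟩
      refine projective_iff_hasProjectiveDimensionLT_one.2
        ((c.hasDominantCoresolution_F hX hX').hasProjectiveDimensionLE (j := 0) (c.finite_F hX) ?_)
      exact glDim_le_iff.1 hgl.le
  tfae_finish

end HomContext

section Coinduced

variable (K : Type w) [Field K] (R : Type u) [Ring R] [Algebra K R] (X : Type u) [AddCommGroup X]
  [Module K X]

/-- The coinduced module `Hom_K(R, X)` with the action `(r • f) s = f (s * r)`. -/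
def Coinduced : Type u := R →ₗ[K] X

namespace Coinduced

instance : AddCommGroup (Coinduced K R X) := inferInstanceAs (AddCommGroup (R →ₗ[K] X))
instance : Module K (Coinduced K R X) := inferInstanceAs (Module K (R →ₗ[K] X))

instance : FunLike (Coinduced K R X) R X := inferInstanceAs (FunLike (R →ₗ[K] X) R X)

instance : SMul R (Coinduced K R X) := ⟨fun r f => LinearMap.comp f (LinearMap.mulRight K r)⟩

variable {K R X}

theorem smul_apply (r : R) (f : Coinduced K R X) (s : R) : (r • f) s = f (s * r) := rfl

theorem add_apply (f g : Coinduced K R X) (s : R) : (f + g) s = f s + g s := rfl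

theorem ext {f g : Coinduced K R X} (h : ∀ s, f s = g s) : f = g := LinearMap.ext h

variable (K R X)

instance : Module R (Coinduced K R X) where
  one_smul f := ext fun s => by rw [smul_apply, mul_one]
  mul_smul r r' f := ext fun s => by rw [smul_apply, smul_apply, smul_apply, mul_assoc]
  smul_zero r := rfl
  smul_add r f g := rfl
  add_smul r r' f := ext fun s => by
    rw [smul_apply, mul_add, add_apply, smul_apply, smul_apply]
    exact LinearMap.map_add f _ _
  zero_smul f := ext fun s => by
    rw [smul_apply, mul_zero]
    exact LinearMap.map_zero f

instance : IsScalarTower K R (Coinduced K R X) where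
  smul_assoc k r f := ext fun s => by
    rw [smul_apply, mul_smul_comm]
    exact LinearMap.map_smul f k (s * r)

instance [Module.Finite K R] [Module.Finite K X] : Module.Finite R (Coinduced K R X) := by
  have : Module.Finite K (Coinduced K R X) := inferInstanceAs (Module.Finite K (R →ₗ[K] X))
  exact Module.Finite.of_restrictScalars_finite K R _

theorem injective : Module.Injective R (Coinduced K R X) := by
  refine Module.Baer.injective fun J g => ?_
  let φ : J.restrictScalars K →ₗ[K] X :=
    { toFun := fun i => g ⟨i.1, i.2⟩ 1
      map_add' := fun i j => by
        rw [← add_apply, ← map_add]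
        rfl
      map_smul' := fun k i => by
        have : (⟨k • i.1, (k • i).2⟩ : J) = k • ⟨i.1, i.2⟩ := rfl
        have h : g (k • ⟨i.1, i.2⟩) = k • g ⟨i.1, i.2⟩ := by
          rw [← algebraMap_smul R k, map_smul, algebraMap_smul]
        exact congrArg (fun f : Coinduced K R X => f 1) h }
  obtain ⟨ψ, hψ⟩ := LinearMap.exists_extend φ
  refine ⟨LinearMap.toSpanSingleton R (Coinduced K R X) (ψ : Coinduced K R X), fun i hi => ?_⟩
  refine ext fun s => ?_
  have h1 : ψ (s * i) = g (s • ⟨i, hi⟩) 1 :=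
    DFunLike.congr_fun hψ ⟨s * i, J.mul_mem_left s hi⟩
  refine Eq.trans (b := g (s • ⟨i, hi⟩) 1) h1 ?_
  rw [map_smul, smul_apply, one_mul]

variable [Module R X] [IsScalarTower K R X]

/-- The embedding of a module into the coinduced module. -/
def unit : X →ₗ[R] Coinduced K R X where
  toFun x := ((LinearMap.toSpanSingleton R X x).restrictScalars K : R →ₗ[K] X)
  map_add' x y := ext fun s => smul_add s x y
  map_smul' r x := ext fun s => (mul_smul s r x).symm

theorem unit_apply (x : X) (s : R) : unit K R X x s = s • x := rfl

theorem unit_injective : Function.Injective (unit K R X) := fun x y h => by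
  have : (unit K R X x) 1 = (unit K R X y) 1 := by rw [h]
  simpa [unit_apply] using this

end Coinduced

end Coinduced

section Main

variable {R : Type u} [Ring R]

theorem exists_injective_add (K : Type w) [Field K] [Algebra K R] [Module.Finite K R]
    {M : ModuleCat.{u} R} (hM : IsCogenerator M) (X : ModuleCat.{u} R) (hX : Module.Finite R X) :
    ∃ (I : ModuleCat.{u} R) (f : X ⟶ I), Mono f ∧ Injective I ∧ add M I := by
  let _ : Module K X := Module.compHom X (algebraMap K R)
  have : IsScalarTower K R X :=
    ⟨fun k r x => by rw [Algebra.smul_def, mul_smul]; rfl⟩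
  have : Module.Finite K X := Module.Finite.trans R X
  have hI : Injective (ModuleCat.of R (Coinduced K R X)) :=
    (Module.injective_iff_injective_object R _).1 (Coinduced.injective K R X)
  refine ⟨ModuleCat.of R (Coinduced K R X), ModuleCat.ofHom (Coinduced.unit K R X),
    (ModuleCat.mono_iff_injective _).2 (Coinduced.unit_injective K R X), hI, ?_⟩
  obtain ⟨n, f, hf⟩ := hM (ModuleCat.of R (Coinduced K R X))
    (inferInstanceAs (Module.Finite R (Coinduced K R X)))
  have : Mono (ModuleCat.ofHom f) := (ModuleCat.mono_iff_injective _).2 hf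
  exact ⟨n, ⟨⟨ModuleCat.ofHom f, Injective.factorThru (𝟙 _) (ModuleCat.ofHom f),
    Injective.comp_factorThru _ _⟩⟩⟩

theorem IsGenerator.isSeparator {M : ModuleCat.{u} R} (hM : IsGenerator M) : IsSeparator M := by
  rw [Preadditive.isSeparator_iff]
  intro X Y f hf
  obtain ⟨n, p, hp⟩ := hM (ModuleCat.of R R) (inferInstanceAs (Module.Finite R R))
  ext x
  obtain ⟨v, hv⟩ := hp (1 : R)
  let φ : ModuleCat.of R R →ₗ[R] X := LinearMap.toSpanSingleton R X x
  have hφ : f.hom ∘ₗ φ ∘ₗ p = 0 := by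
    refine LinearMap.pi_ext' fun j => ?_
    exact congrArg ModuleCat.Hom.hom
      (hf (ModuleCat.ofHom (φ ∘ₗ p ∘ₗ LinearMap.single R (fun _ => M) j)))
  have h1 : f.hom (φ (p v)) = 0 := DFunLike.congr_fun hφ v
  have h2 : φ (1 : R) = x := one_smul R x
  rw [hv, h2] at h1
  exact h1

variable (M : Type u) [AddCommGroup M] [Module R M]

/-- The right action of the endomorphism ring, in the two available forms. -/
def endOpEquiv : (Module.End R M)ᵐᵒᵖ ≃+* (CategoryTheory.End (ModuleCat.of R M))ᵐᵒᵖ :=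
  (ModuleCat.endRingEquiv (ModuleCat.of R M)).symm.op

/-- The functor `Hom(M, -)` sends `M` to the regular module. -/
noncomputable def endIso :
    (ModuleCat.restrictScalars (endOpEquiv (R := R) M : _ →+* _)).obj
      ((preadditiveCoyonedaObj (ModuleCat.of R M)).obj (ModuleCat.of R M)) ≅
    ModuleCat.of (Module.End R M)ᵐᵒᵖ (Module.End R M)ᵐᵒᵖ where
  hom := ModuleCat.homEquiv.symm
    { toFun := fun f => MulOpposite.op
        (ModuleCat.Hom.hom (A := ModuleCat.of R M) (B := ModuleCat.of R M) f)
      map_add' := fun _ _ => rfl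
      map_smul' := fun _ _ => rfl }
  inv := ModuleCat.homEquiv.symm
    { toFun := fun a => (ModuleCat.ofHom (MulOpposite.unop a) : ModuleCat.of R M ⟶ ModuleCat.of R M)
      map_add' := fun _ _ => rfl
      map_smul' := fun _ _ => rfl }
  hom_inv_id := rfl
  inv_hom_id := rfl

/-- The Gabriel–Popescu situation of a generator-cogenerator. -/
noncomputable def homContext (hfin : Module.Finite R M)
    (hgen : IsGenerator (ModuleCat.of R M))
    (hinj : ∀ X : ModuleCat.{u} R, Module.Finite R X →
      ∃ (I : ModuleCat.{u} R) (f : X ⟶ I), Mono f ∧ Injective I ∧ add (ModuleCat.of R M) I) :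
    HomContext (ModuleCat.of R M) (Module.End R M)ᵐᵒᵖ :=
  let G := ModuleCat.of R M
  let E := ModuleCat.restrictScalarsEquivalenceOfRingEquiv (endOpEquiv (R := R) M)
  let adj := E.symm.toAdjunction.comp
    (IsGrothendieckAbelian.tensorObjPreadditiveCoyonedaObjAdjunction G)
  have := IsGrothendieckAbelian.GabrielPopescu.full G hgen.isSeparator
  have := (isSeparator_iff_faithful_preadditiveCoyonedaObj G).1 hgen.isSeparator
  have := IsGrothendieckAbelian.GabrielPopescu.preservesFiniteLimits G hgen.isSeparator
  have hT : PreservesFiniteLimits (E.inverse ⋙ IsGrothendieckAbelian.tensorObj G) :=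
    comp_preservesFiniteLimits _ _
  { F := preadditiveCoyonedaObj G ⋙ E.functor
    T := E.inverse ⋙ IsGrothendieckAbelian.tensorObj G
    adj := adj
    full := inferInstance
    faithful := inferInstance
    additive := inferInstance
    preservesInjectiveObjects := by
      have : (E.inverse ⋙ IsGrothendieckAbelian.tensorObj G).PreservesMonomorphisms := inferInstance
      exact Functor.preservesInjectiveObjects_of_adjunction_of_preservesMonomorphisms adj
    preservesFiniteLimits := hT
    isoM := endIso M
    finite := hfin
    exists_injective := hinj }

/-- The regular right module over a ring as a left module over the opposite ring. -/
def opIso (A : Type u) [Ring A] : ModuleCat.of Aᵐᵒᵖ A ≅ ModuleCat.of Aᵐᵒᵖ Aᵐᵒᵖ :=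
  LinearEquiv.toModuleIso
    { MulOpposite.opAddEquiv with map_smul' := fun _ _ => rfl }

theorem domDim_eq_of_iso [IsNoetherianRing R] {X Y : ModuleCat.{u} R} (e : X ≅ Y)
    (hX : Module.Finite R X) : domDim X = domDim Y := by
  refine ENat.eq_of_forall_natCast_le_iff fun n => ?_
  rw [le_domDim_iff hX, le_domDim_iff (finite_of_epi e.hom hX)]
  exact ⟨fun h => h.of_retract e.symm.retract, fun h => h.of_retract e.retract⟩

theorem isNoetherianRing_end_op (K : Type w) [Field K] [Algebra K R] [Module.Finite K R]
    [Module.Finite R M] : IsNoetherianRing (Module.End R M)ᵐᵒᵖ := by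
  let _ : Module K M := Module.compHom M (algebraMap K R)
  have : IsScalarTower K R M :=
    ⟨fun k r x => by rw [Algebra.smul_def, mul_smul]; rfl⟩
  have : SMulCommClass R K M := IsScalarTower.to_smulCommClass'
  have : Module.Finite K M := Module.Finite.trans R M
  have : Module.Finite K (Module.End R M) :=
    Module.Finite.of_injective (LinearMap.restrictScalarsₗ K R M M K)
      (LinearMap.restrictScalars_injective K)
  exact IsNoetherianRing.of_finite K _

end Main

end DomDim

theorem mainTheorem7
    {K : Type w} [Field K]
    -- a finite dimensional, non-semisimple algebra
    {B : Type u} [Ring B] [Algebra K B] [Module.Finite K B] (hB : ¬ IsSemisimpleRing B)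
    -- a finite dimensional right module that is a generator-cogenerator
    (M : Type u) [AddCommGroup M] [Module Bᵐᵒᵖ M] [Module.Finite Bᵐᵒᵖ M]
    (hgen : DomDim.IsGenerator (ModuleCat.of Bᵐᵒᵖ M))
    (hcog : DomDim.IsCogenerator (ModuleCat.of Bᵐᵒᵖ M))
    (d : ℕ) (hd : 2 ≤ d) :
    List.TFAE
      [DomDim.proj (Module.End Bᵐᵒᵖ M)ᵐᵒᵖ = DomDim.Dom (Module.End Bᵐᵒᵖ M)ᵐᵒᵖ d,
        DomDim.algDomDim (Module.End Bᵐᵒᵖ M) = (d : ℕ∞) ∧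
          DomDim.glDim (Module.End Bᵐᵒᵖ M)ᵐᵒᵖ = (d : WithBot ℕ∞),
        DomDim.IsMaximalOrthogonal (ModuleCat.of Bᵐᵒᵖ M) (d - 2)] := by
  obtain ⟨n, rfl⟩ := Nat.exists_eq_add_of_le' hd
  have : IsNoetherianRing Bᵐᵒᵖ := IsNoetherianRing.of_finite K _
  have : IsNoetherianRing (Module.End Bᵐᵒᵖ M)ᵐᵒᵖ := DomDim.isNoetherianRing_end_op M K
  have hdom : DomDim.algDomDim (Module.End Bᵐᵒᵖ M) =
      DomDim.domDim (ModuleCat.of (Module.End Bᵐᵒᵖ M)ᵐᵒᵖ (Module.End Bᵐᵒᵖ M)ᵐᵒᵖ) :=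
    (DomDim.domDim_eq_of_iso (DomDim.opIso (Module.End Bᵐᵒᵖ M)).symm
      (inferInstanceAs (Module.Finite (Module.End Bᵐᵒᵖ M)ᵐᵒᵖ (Module.End Bᵐᵒᵖ M)ᵐᵒᵖ))).symm
  rw [hdom, Nat.add_sub_cancel]
  exact (DomDim.homContext M inferInstance hgen (DomDim.exists_injective_add K hcog)).tfae
    (fun h => hB (isSemisimpleRing_mulOpposite_iff.1 h)) n
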